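/- Let $\$:[0,+\infty)\times\{1,2,3,\dots\}\to[1,+\infty]$ be a cost function, i.e. $\$(\sigma,d)$ is non-increasing in $\sigma$ and non-decreasing in $d$. For $d\ge 1$ put $$h_1(x,d)=\$\big(\sqrt{1/x},\,d\big)\quad(x>0),\qquad h_{2,\lambda}(x,d)=\$\Big(\sqrt{\tfrac{\lambda x}{\lambda-x}},\,d\Big)\quad(0<x<\lambda).$$ Consider approximating an unknown real number $f\in\mathbb R$ from adaptive noisy observations $$y_i=f+e_i,\qquad e_i\sim\mathcal N\big(0,\sigma_i^2(y_1,\dots,y_{i-1})\big),\qquad i=1,2,\dots,n(\mathbf y),$$ with independent noise (that is, $e_i=\sigma_i(y_1,\dots,y_{i-1})\,\xi_i$ with i.i.d. standard Gaussian $\xi_i$). Here the precisions $\sigma_i(\cdot)\in[0,\infty)$ are measurable functions of the previously obtained values, and the process terminates when $(y_1,\dots,y_n)\in Y$, where $Y$ is a measurable set of finite real sequences such that every infinite sequence $(y_1,y_2,\dots)$ has exactly one initial segment in $Y$. Such a choice of precisions and of $Y$ is called information $N$; let $\pi_f$ be the distribution on $Y$ of the information $\mathbf y=(y_1,\dots,y_{n(\mathbf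 y)})$ about $f$. For a measurable algorithm $\Phi:Y\to\mathbb R$ let $$\mathrm{cost}(N)=\sup_{f\in\mathbb R}\int_Y\sum_{i=1}^{n(\mathbf y)}\$\big(\sigma_i(y_1,\dots,y_{i-1}),d\big)\,\pi_f(\mathrm d\mathbf y),\qquad \mathrm e(N,\Phi)=\sup_{f\in\mathbb R}\Big(\int_Y|f-\Phi(\mathbf y)|^2\,\pi_f(\mathrm d\mathbf y)\Big)^{1/2},$$ and define the auxiliary cost function $$\widehat{\$}(\sigma,d)=\inf\{\mathrm{cost}(N):\ N,\Phi\text{ such that }\mathrm e(N,\Phi)\le\sigma\},\qquad \sigma\ge 0 .$$ Then for every $d\ge 1$ the following hold. (i) If $h_1(\cdot,d)$ is concave on $(0,\infty)$ and $h_{2,\lambda}(\cdot,d)$ is convex on $(0,\lambda)$ for all sufficiently large $\lambda$, then $\widehat{\$}(\sigma,d)=\$(\sigma,d)$ for all $\sigma\ge 0$. (ii) Suppose that there are $\alpha\in\mathbb R$ and $x_0>0$ with $\alpha x_0=h_1(x_0,d)$ and $\alpha x\le h_1(x,d)$ for all $x>0$. Then, with $\sigma_0^2=1/x_0$, for all $\sigma>0$,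 $$\frac{\alpha}{\sigma^2}\le\widehat{\$}(\sigma,d)\le\Big\lceil\frac{\sigma_0^2}{\sigma^2}\Big\rceil\frac{\alpha}{\sigma_0^2}.$$ (iii) For all $\sigma_0>0$ and $\sigma>0$, $$\widehat{\$}(\sigma,d)\le\Big\lceil\frac{\sigma_0^2}{\sigma^2}\Big\rceil\,\$(\sigma_0,d).$$ -/

import Mathlib

open Set Filter MeasureTheory ProbabilityTheory
open scoped NNReal ENNReal

noncomputable section

/-- A cost function `$ : [0,∞) × {1,2,…} → [1,∞]`, non-decreasing in `σ⁻¹` (that is, non-increasing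
in `σ`) and non-decreasing in `d`. -/
structure CostFunction where
  toFun : ℝ≥0 → ℕ+ → ℝ≥0∞
  one_le : ∀ σ d, 1 ≤ toFun σ d
  antitone_prec : ∀ d, Antitone fun σ => toFun σ d
  monotone_dim : ∀ σ, Monotone fun d => toFun σ d

instance : CoeFun CostFunction (fun _ => ℝ≥0 → ℕ+ → ℝ≥0∞) := ⟨CostFunction.toFun⟩

/-- `h₁(x,d) = $(√(1/x), d)`, of interest for `x ∈ (0,∞)`. -/
def CostFunction.h₁ (c : CostFunction) (d : ℕ+) (x : ℝ≥0) : ℝ≥0∞ :=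
  c (NNReal.sqrt (1 / x)) d

/-- `h_{2,λ}(x,d) = $(√(λx/(λ-x)), d)`, of interest for `x ∈ (0,λ)`. -/
def CostFunction.h₂ (c : CostFunction) (lam : ℝ≥0) (d : ℕ+) (x : ℝ≥0) : ℝ≥0∞ :=
  c (NNReal.sqrt (lam * x / (lam - x))) d

/-- Finite sequences of real numbers, of various lengths (possible values of information). -/
abbrev FinSeq : Type := Σ n : ℕ, Fin n → ℝ

/-- Adaptive information about a real parameter: the precision of the next observation depends on
the previously obtained values, and the process stops as soon as the sequence of obtained values
belongs to `range`. Every infinite sequence has exactly one initial segment in `range`. -/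
structure AdaptiveInfo where
  /-- `prec n (y₁,…,yₙ)` is the precision of the observation number `n + 1`. -/
  prec : (n : ℕ) → (Fin n → ℝ) → ℝ≥0
  measurable_prec : ∀ n, Measurable (prec n)
  /-- The set `Y` of all values of information. -/
  range : Set FinSeq
  measurableSet_range : MeasurableSet range
  existsUnique_length : ∀ y : ℕ → ℝ, ∃! n : ℕ, (⟨n, fun i => y i⟩ : FinSeq) ∈ range

namespace AdaptiveInfo

/-- The successive observations `yₙ = f + eₙ` with noise `eₙ = σₙ(y₁,…,yₙ₋₁) ξₙ`, where the `ξₙ`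
will be independent standard Gaussian variables. -/
def obs (N : AdaptiveInfo) (f : ℝ) (ξ : ℕ → ℝ) (n : ℕ) : ℝ :=
  f + (N.prec n fun i : Fin n => obs N f ξ i) * ξ n
termination_by n
decreasing_by exact i.2

/-- The number of observations made along the sequence `y`. -/
def length (N : AdaptiveInfo) (y : ℕ → ℝ) : ℕ := (N.existsUnique_length y).choose

/-- The value of information: the initial segment of `y` at which the process stops. -/
def stopped (N : AdaptiveInfo) (y : ℕ → ℝ) : FinSeq := ⟨N.length y, fun i => y i⟩

/-- The distribution `π_f` of the information about `f`. -/
def law (N : AdaptiveInfo) (f : ℝ) : Measure FinSeq :=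
  (Measure.infinitePi fun _ : ℕ => gaussianReal 0 1).map fun ξ => N.stopped (N.obs f ξ)

/-- The cost of a value `y = (y₁,…,yₙ)` of information, `∑ᵢ $(σᵢ(y₁,…,yᵢ₋₁), d)`. -/
def pathCost (N : AdaptiveInfo) (c : CostFunction) (d : ℕ+) (y : FinSeq) : ℝ≥0∞ :=
  ∑ i : Fin y.1, c (N.prec i fun j : Fin i => y.2 (j.castLE i.2.le)) d

/-- The worst case expected cost of information, over all `f ∈ ℝ`. -/
def cost (N : AdaptiveInfo) (c : CostFunction) (d : ℕ+) : ℝ≥0∞ :=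
  ⨆ f : ℝ, ∫⁻ y, N.pathCost c d y ∂(N.law f)

/-- The worst case root mean square error of the algorithm `Φ`, over all `f ∈ ℝ`. -/
def error (N : AdaptiveInfo) (Φ : FinSeq → ℝ) : ℝ≥0∞ :=
  ⨆ f : ℝ, (∫⁻ y, ENNReal.ofReal ((f - Φ y) ^ 2) ∂(N.law f)) ^ (1 / 2 : ℝ)

/-- The map defining `law` is measurable, so that `law` is an image measure in the usual sense. -/
theorem measurable_stopped_obs (N : AdaptiveInfo) (f : ℝ) :
    Measurable fun ξ : ℕ → ℝ => N.stopped (N.obs f ξ) := by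
  have hobs : ∀ n, Measurable fun ξ : ℕ → ℝ => N.obs f ξ n := by
    intro n
    induction n using Nat.strong_induction_on with
    | _ n ih =>
      have h : (fun ξ : ℕ → ℝ => N.obs f ξ n) =
          fun ξ => f + (N.prec n fun i : Fin n => N.obs f ξ i) * ξ n := by
        funext ξ
        rw [obs]
      rw [h]
      have h2 : Measurable fun ξ : ℕ → ℝ => N.prec n fun i : Fin n => N.obs f ξ i :=
        (N.measurable_prec n).comp (measurable_pi_lambda _ fun i => ih i i.2)
      exact (h2.coe_nnreal_real.mul (measurable_pi_apply n)).const_add f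
  have hst : Measurable N.stopped := by
    intro S hS
    have : N.stopped ⁻¹' S =
        ⋃ n : ℕ, {y : ℕ → ℝ | (⟨n, fun i => y i⟩ : FinSeq) ∈ N.range ∩ S} := by
      ext y
      simp only [mem_preimage, mem_iUnion, mem_ofPred_eq, mem_inter_iff]
      constructor
      · intro h
        exact ⟨N.length y, (N.existsUnique_length y).choose_spec.1, h⟩
      · rintro ⟨n, h1, h2⟩
        have : n = N.length y := (N.existsUnique_length y).choose_spec.2 n h1
        subst this
        exact h2
    rw [this]
    refine MeasurableSet.iUnion fun n => ?_
    have h1 : Measurable fun y : ℕ → ℝ => (fun i : Fin n => y i) :=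
      measurable_pi_lambda _ fun i => measurable_pi_apply _
    have h2 : Measurable (Sigma.mk (β := fun n : ℕ => Fin n → ℝ) n) := fun s hs => by
      rw [MeasurableSpace.measurableSet_iInf] at hs
      exact hs n
    exact (h2.comp h1) (N.measurableSet_range.inter hS)
  exact hst.comp (measurable_pi_lambda _ hobs)

end AdaptiveInfo

/-- The auxiliary cost function `$̂`: `auxCost c σ d` is the minimal cost of information sufficient
for approximating a real parameter with error at most `σ`, when single observations
are charged by `c · d`. -/
def auxCost (c : CostFunction) (σ : ℝ≥0) (d : ℕ+) : ℝ≥0∞ :=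
  sInf {C | ∃ (N : AdaptiveInfo) (Φ : FinSeq → ℝ), Measurable Φ ∧
    N.error Φ ≤ (σ : ℝ≥0∞) ∧ C = N.cost c d}

end

/-! The upper bounds come from averaging `n` observations of equal precision `σ₀`: the mean square
error is `σ₀² / n` for every `f`. The lower bounds are Bayesian. Worst case cost and error dominate
their averages over a centered normal prior of variance `λ`. Adaptivity does not spoil conjugacy:
given the observations, the parameter is normal with variance `V = (λ⁻¹ + S)⁻¹`, where `S = ∑ σᵢ⁻²`
(`exists_posterior`). No algorithm beats the expected posterior variance, so error at most `σ`
forces `E V ≤ σ²` (`lintegral_bayesLaw_posteriorVar_le`). What remains is to bound the cost of a run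
below by a convex function of `V` and to apply Jensen's inequality through a supporting line. For
(i), a nonnegative concave `h₁` is subadditive, so a run costs at least `h₁(S) = h_{2,λ}(V)`
(`h₁_information_le_pathCost`). Since `h_{2,λ}` is convex and non-increasing, the cost is at least
`h_{2,λ}(σ²) = h₁(σ⁻² - λ⁻¹)` (`h₂_le_cost`), and `λ → ∞` gives `$(σ)`. For (ii), a run costs at
least `α S = α (V⁻¹ - λ⁻¹)`, and `V ↦ V⁻¹` is convex (`ofReal_div_sq_le_cost`). -/

/-! ### The normal posterior after one observation. -/

theorem measurable_finSnoc {n : ℕ} :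
    Measurable fun p : (Fin n → ℝ) × ℝ => (Fin.snoc p.1 p.2 : Fin (n + 1) → ℝ) := by
  refine measurable_pi_lambda _ fun i => ?_
  induction i using Fin.lastCases with
  | last => simpa using measurable_snd
  | cast i => simpa using by fun_prop

theorem measurable_finInit {n : ℕ} :
    Measurable fun y : Fin (n + 1) → ℝ => (Fin.init y : Fin n → ℝ) :=
  measurable_pi_lambda _ fun i => measurable_pi_apply i.castSucc

/-- The standard Gaussian measure on the plane is rotation invariant. The order of integration is
chosen so that `q` can carry the new observation and the inner `p` the uncertainty that remains. -/
theorem lintegral_gaussian_rotation (F : ℝ × ℝ → ℝ≥0∞) (hF : Measurable F) (θ : ℝ) :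
    ∫⁻ z, ∫⁻ t, F (z, t) ∂gaussianReal 0 1 ∂gaussianReal 0 1 =
      ∫⁻ q, ∫⁻ p, F (Real.cos θ * p + Real.sin θ * q, -Real.sin θ * p + Real.cos θ * q)
        ∂gaussianReal 0 1 ∂gaussianReal 0 1 := by
  have hrot := IsGaussian.map_rotation_eq_self (μ := gaussianReal 0 1) (by simp) θ
  rw [← lintegral_prod _ hF.aemeasurable, ← hrot,
    lintegral_map hF (ContinuousLinearMap.continuous _).measurable]
  simp only [ContinuousLinearMap.rotation_apply, smul_eq_mul]
  rw [lintegral_prod_symm' _ (by fun_prop)]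

/-- If, conditionally on `y`, the parameter is normal with mean `m y` and standard deviation `r y`,
then after an observation with precision `s y` it is normal again. -/
theorem posterior_step {n : ℕ} (J : Measure (ℝ × (Fin n → ℝ))) (J' : Measure (ℝ × (Fin (n + 1) → ℝ)))
    (s m r : (Fin n → ℝ) → ℝ) (hs : Measurable s) (hm : Measurable m) (hr : Measurable r)
    (hstep : ∀ F : ℝ × (Fin (n + 1) → ℝ) → ℝ≥0∞, Measurable F →
      ∫⁻ p, F p ∂J' = ∫⁻ p, ∫⁻ t, F (p.1, Fin.snoc p.2 (p.1 + s p.2 * t)) ∂gaussianReal 0 1 ∂J)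
    (hpost : ∀ F : ℝ × (Fin n → ℝ) → ℝ≥0∞, Measurable F →
      ∫⁻ p, F p ∂J = ∫⁻ p, ∫⁻ z, F (m p.2 + r p.2 * z, p.2) ∂gaussianReal 0 1 ∂J) :
    ∃ m' : (Fin (n + 1) → ℝ) → ℝ, Measurable m' ∧
      ∀ F : ℝ × (Fin (n + 1) → ℝ) → ℝ≥0∞, Measurable F →
      ∫⁻ p, F p ∂J' = ∫⁻ p, ∫⁻ z, F (m' p.2 + r (Fin.init p.2) *
        Real.cos (Complex.arg ⟨s (Fin.init p.2), r (Fin.init p.2)⟩) * z, p.2)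
          ∂gaussianReal 0 1 ∂J' := by
  -- Polar coordinates of `s + i r`: rotating by `θ` turns `r z + s t` into `ρ q`. Using the
  -- argument avoids dividing by `s² + r²`, so `s = r = 0` needs no separate case.
  set θ : (Fin n → ℝ) → ℝ := fun y => Complex.arg ⟨s y, r y⟩ with hθ
  set ρ : (Fin n → ℝ) → ℝ := fun y => ‖(⟨s y, r y⟩ : ℂ)‖ with hρ
  have hθm : Measurable θ :=
    Complex.measurable_arg.comp (Complex.measurableEquivRealProd.symm.measurable.comp (hs.prodMk hr))
  have hcos : ∀ y, ρ y * Real.cos (θ y) = s y := fun y => Complex.norm_mul_cos_arg _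
  have hsin : ∀ y, ρ y * Real.sin (θ y) = r y := fun y => Complex.norm_mul_sin_arg _
  have hi := measurable_finInit (n := n)
  have hsn := measurable_finSnoc (n := n)
  have hrot : ∀ F : ℝ × (Fin (n + 1) → ℝ) → ℝ≥0∞, Measurable F →
      ∫⁻ p, F p ∂J' = ∫⁻ p, ∫⁻ q, ∫⁻ x, F (m p.2 + r p.2 *
        (Real.cos (θ p.2) * x + Real.sin (θ p.2) * q), Fin.snoc p.2 (m p.2 + ρ p.2 * q))
          ∂gaussianReal 0 1 ∂gaussianReal 0 1 ∂J := by
    intro F hF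
    -- The posterior is encoded as a resampling identity rather than a conditional kernel: redraw
    -- the parameter as `m + r z`, then rotate `(z, t)`.
    rw [hstep F hF, hpost]
    · refine lintegral_congr fun p => ?_
      rw [lintegral_gaussian_rotation
        (fun u => F (m p.2 + r p.2 * u.1, Fin.snoc p.2 (m p.2 + r p.2 * u.1 + s p.2 * u.2)))
        _ (θ p.2)]
      · refine lintegral_congr fun q => lintegral_congr fun x => ?_
        have : m p.2 + r p.2 * (Real.cos (θ p.2) * x + Real.sin (θ p.2) * q) +
            s p.2 * (-Real.sin (θ p.2) * x + Real.cos (θ p.2) * q) = m p.2 + ρ p.2 * q := by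
          rw [← hcos, ← hsin]
          linear_combination (ρ p.2 * q) * Real.sin_sq_add_cos_sq (θ p.2)
        simp only [this]
      · refine hF.comp (Measurable.prodMk (by fun_prop) (hsn.comp (Measurable.prodMk ?_ ?_)))
        <;> fun_prop
    · refine Measurable.lintegral_prod_right' (f := fun u : (ℝ × (Fin n → ℝ)) × ℝ =>
        F (u.1.1, Fin.snoc u.1.2 (u.1.1 + s u.1.2 * u.2))) ?_
      refine hF.comp (Measurable.prodMk (by fun_prop) (hsn.comp (Measurable.prodMk ?_ ?_)))
      <;> fun_prop
  -- The usual precision-weighted mean: if `s, r` are not both zero, the weights are `s² / (s² +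
  -- r²)` on the old mean and `r² / (s² + r²)` on the new value.
  refine ⟨fun y => Real.cos (θ (Fin.init y)) ^ 2 * m (Fin.init y) +
    Real.sin (θ (Fin.init y)) ^ 2 * y (Fin.last n), by fun_prop, fun F hF => ?_⟩
  -- On the right the integrand no longer involves the parameter itself, so after rotation its
  -- `x`-integral is trivial.
  rw [hrot F hF, hrot]
  · refine lintegral_congr fun p => lintegral_congr fun q => ?_
    simp only [Fin.init_snoc, Fin.snoc_last, lintegral_const, measure_univ, mul_one]
    refine lintegral_congr fun x => ?_
    congr 2
    change _ = _ + r p.2 * Real.cos (θ p.2) * x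
    rw [← hsin]
    linear_combination (-m p.2) * Real.sin_sq_add_cos_sq (θ p.2)
  · refine Measurable.lintegral_prod_right' (f := fun u : (ℝ × (Fin (n + 1) → ℝ)) × ℝ =>
        F (Real.cos (θ (Fin.init u.1.2)) ^ 2 * m (Fin.init u.1.2) +
          Real.sin (θ (Fin.init u.1.2)) ^ 2 * u.1.2 (Fin.last n) + r (Fin.init u.1.2) *
        Real.cos (θ (Fin.init u.1.2)) * u.2, u.1.2)) ?_
    refine hF.comp (Measurable.prodMk ?_ (by fun_prop))
    fun_prop

/-- Precisions add: `r² cos² θ = r² s² / (r² + s²)`. With `0⁻¹ = ∞` this also covers exact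
observations and degenerate priors. -/
theorem inv_ofReal_mul_cos_arg_sq {s r : ℝ} :
    (ENNReal.ofReal ((r * Real.cos (Complex.arg ⟨s, r⟩)) ^ 2))⁻¹ =
      (ENNReal.ofReal (r ^ 2))⁻¹ + (ENNReal.ofReal (s ^ 2))⁻¹ := by
  by_cases hr : r = 0
  · simp [hr]
  by_cases hs : s = 0
  · have : (⟨s, r⟩ : ℂ) = r * Complex.I := by apply Complex.ext <;> simp [hs]
    have h := Complex.norm_mul_cos_arg ⟨s, r⟩
    have hn : ‖(⟨s, r⟩ : ℂ)‖ ≠ 0 := by rw [this]; simpa using hr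
    have h0 : Real.cos (Complex.arg ⟨s, r⟩) = 0 :=
      (mul_eq_zero.1 (h.trans hs)).resolve_left hn
    rw [h0]
    simp [hs]
  · have h := Complex.norm_mul_cos_arg ⟨s, r⟩
    have hn : ‖(⟨s, r⟩ : ℂ)‖ ^ 2 = s ^ 2 + r ^ 2 := by
      rw [← Complex.normSq_eq_norm_sq, Complex.normSq_mk]; ring
    have hpos : 0 < s ^ 2 + r ^ 2 := by positivity
    have h2 : (s ^ 2 + r ^ 2) * Real.cos (Complex.arg ⟨s, r⟩) ^ 2 = s ^ 2 := by
      rw [← hn, ← mul_pow, h]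
    have h3 : Real.cos (Complex.arg ⟨s, r⟩) ^ 2 = s ^ 2 / (s ^ 2 + r ^ 2) := by
      field_simp; linarith
    rw [mul_pow, h3, ← ENNReal.ofReal_inv_of_pos (by positivity),
      ← ENNReal.ofReal_inv_of_pos (by positivity), ← ENNReal.ofReal_inv_of_pos (by positivity),
      ← ENNReal.ofReal_add (by positivity) (by positivity)]
    congr 1
    field_simp

/-! ### Joint law of a normal parameter and its adaptive observations. -/

theorem lintegral_infinitePi_succ (n : ℕ) (F : (Fin n → ℝ) × ℝ → ℝ≥0∞) (hF : Measurable F) :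
    ∫⁻ ξ, F (fun i => ξ i, ξ n) ∂(Measure.infinitePi fun _ : ℕ => gaussianReal 0 1) =
      ∫⁻ ξ, ∫⁻ t, F (fun i => ξ i, t) ∂gaussianReal 0 1
        ∂(Measure.infinitePi fun _ : ℕ => gaussianReal 0 1) := by
  set P := Measure.infinitePi fun _ : ℕ => gaussianReal 0 1
  have hind : iIndepFun (fun (i : ℕ) (ξ : ℕ → ℝ) => ξ i) P :=
    iIndepFun_infinitePi (X := fun _ x => x) fun _ => measurable_id
  have h1 := hind.indepFun_finset (Finset.range n) {n} (by simp) fun i => measurable_pi_apply i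
  have h2 : IndepFun (fun ξ : ℕ → ℝ => (fun i : Fin n => ξ i)) (fun ξ : ℕ → ℝ => ξ n) P :=
    h1.comp (φ := fun w : Finset.range n → ℝ => fun i : Fin n => w ⟨i, by simp⟩)
      (ψ := fun w : ({n} : Finset ℕ) → ℝ => w ⟨n, by simp⟩)
      (measurable_pi_lambda _ fun i => measurable_pi_apply _) (measurable_pi_apply _)
  have hm : Measurable fun ξ : ℕ → ℝ => (fun i : Fin n => ξ i) :=
    measurable_pi_lambda _ fun i => measurable_pi_apply _
  rw [indepFun_iff_map_prod_eq_prod_map_map hm.aemeasurable (measurable_pi_apply n).aemeasurable,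
    Measure.infinitePi_map_eval] at h2
  rw [← lintegral_map hF (hm.prodMk (measurable_pi_apply n)), h2, lintegral_prod _ hF.aemeasurable,
    lintegral_map hF.lintegral_prod_right' hm]

theorem measurable_finSeqMk (n : ℕ) : Measurable (Sigma.mk (β := fun n : ℕ => Fin n → ℝ) n) :=
  fun s hs => by
    rw [MeasurableSpace.measurableSet_iInf] at hs
    exact hs n

theorem measurable_of_comp_finSeqMk {α : Type*} [MeasurableSpace α] {g : FinSeq → α}
    (h : ∀ n, Measurable fun y : Fin n → ℝ => g ⟨n, y⟩) : Measurable g := by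
  intro s hs
  rw [MeasurableSpace.measurableSet_iInf]
  exact fun n => h n hs

/-- The distribution of the noise: independent standard Gaussian variables. -/
noncomputable abbrev gaussianNoise : Measure (ℕ → ℝ) :=
  Measure.infinitePi fun _ : ℕ => gaussianReal 0 1

namespace AdaptiveInfo

variable (N : AdaptiveInfo)

theorem obs_congr (f : ℝ) {ξ ξ' : ℕ → ℝ} (n : ℕ) (h : ∀ i ≤ n, ξ i = ξ' i) :
    N.obs f ξ n = N.obs f ξ' n := by
  induction n using Nat.strong_induction_on with
  | _ n ih =>
    rw [obs, obs, h n le_rfl]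
    have : (fun i : Fin n => N.obs f ξ i) = fun i : Fin n => N.obs f ξ' i :=
      funext fun i => ih i i.2 fun j hj => h j (hj.trans i.2.le)
    rw [this]

theorem measurable_obs (n : ℕ) : Measurable fun u : ℝ × (ℕ → ℝ) => N.obs u.1 u.2 n := by
  induction n using Nat.strong_induction_on with
  | _ n ih =>
    have h : (fun u : ℝ × (ℕ → ℝ) => N.obs u.1 u.2 n) =
        fun u : ℝ × (ℕ → ℝ) => u.1 + (N.prec n fun i : Fin n => N.obs u.1 u.2 i) * u.2 n := by
      funext u
      rw [obs]
    rw [h]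
    have h2 : Measurable fun u : ℝ × (ℕ → ℝ) => N.prec n fun i : Fin n => N.obs u.1 u.2 i :=
      (N.measurable_prec n).comp (measurable_pi_lambda _ fun i => ih i i.2)
    exact measurable_fst.add
      (h2.coe_nnreal_real.mul ((measurable_pi_apply n).comp measurable_snd))

theorem length_mem (y : ℕ → ℝ) : N.stopped y ∈ N.range :=
  (N.existsUnique_length y).choose_spec.1

theorem length_eq_iff (y : ℕ → ℝ) (n : ℕ) :
    N.length y = n ↔ (⟨n, fun i => y i⟩ : FinSeq) ∈ N.range := by
  constructor
  · rintro rfl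
    exact N.length_mem y
  · exact fun h => ((N.existsUnique_length y).choose_spec.2 n h).symm

theorem measurable_stopped : Measurable N.stopped := by
  intro S hS
  have : N.stopped ⁻¹' S =
      ⋃ n : ℕ, {y : ℕ → ℝ | (⟨n, fun i => y i⟩ : FinSeq) ∈ N.range ∩ S} := by
    ext y
    simp only [mem_preimage, mem_iUnion, mem_ofPred_eq, mem_inter_iff]
    constructor
    · exact fun h => ⟨N.length y, N.length_mem y, h⟩
    · rintro ⟨n, h1, h2⟩
      obtain rfl := (N.length_eq_iff y n).2 h1
      exact h2
  rw [this]
  refine MeasurableSet.iUnion fun n => ?_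
  have h1 : Measurable fun y : ℕ → ℝ => (fun i : Fin n => y i) :=
    measurable_pi_lambda _ fun i => measurable_pi_apply _
  exact ((measurable_finSeqMk n).comp h1) (N.measurableSet_range.inter hS)

/-- `∑ᵢ g(σᵢ(y₁,…,yᵢ₋₁))` over the observations leading to `y`. -/
noncomputable def pathSum (g : ℝ≥0 → ℝ≥0∞) (y : FinSeq) : ℝ≥0∞ :=
  ∑ i : Fin y.1, g (N.prec i fun j : Fin i => y.2 (j.castLE i.2.le))

theorem measurable_pathSum {g : ℝ≥0 → ℝ≥0∞} (hg : Measurable g) : Measurable (N.pathSum g) := by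
  refine measurable_of_comp_finSeqMk fun n => ?_
  change Measurable fun y : Fin n → ℝ =>
    ∑ i : Fin n, g (N.prec i fun j : Fin i => y (j.castLE i.2.le))
  refine Finset.measurable_fun_sum _ fun i _ => ?_
  exact hg.comp ((N.measurable_prec i).comp (measurable_pi_lambda _ fun j => measurable_pi_apply _))

theorem pathSum_succ (g : ℝ≥0 → ℝ≥0∞) {n : ℕ} (y : Fin (n + 1) → ℝ) :
    N.pathSum g ⟨n + 1, y⟩ = N.pathSum g ⟨n, Fin.init y⟩ + g (N.prec n (Fin.init y)) := by
  unfold pathSum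
  rw [Fin.sum_univ_castSucc]
  rfl

theorem pathCost_eq_pathSum (c : CostFunction) (d : ℕ+) :
    N.pathCost c d = N.pathSum fun σ => c σ d := rfl

/-- The total Fisher information `∑ᵢ σᵢ⁻²` of the observations leading to `y`. -/
noncomputable def information : FinSeq → ℝ≥0∞ := N.pathSum fun σ => ((σ : ℝ≥0∞) ^ 2)⁻¹

theorem measurable_information : Measurable N.information :=
  N.measurable_pathSum (by fun_prop)

/-- The joint distribution of the parameter and its first `n` observations, when the parameter is
centered Gaussian with standard deviation `ℓ`. -/
noncomputable def joint (ℓ : ℝ) (n : ℕ) : Measure (ℝ × (Fin n → ℝ)) :=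
  ((gaussianReal 0 1).prod gaussianNoise).map fun u =>
    (ℓ * u.1, fun i : Fin n => N.obs (ℓ * u.1) u.2 i)

theorem measurable_obs_scaled (ℓ : ℝ) (n : ℕ) :
    Measurable fun u : ℝ × (ℕ → ℝ) => N.obs (ℓ * u.1) u.2 n :=
  (N.measurable_obs n).comp ((measurable_fst.const_mul ℓ).prodMk measurable_snd)

theorem measurable_joint (ℓ : ℝ) (n : ℕ) : Measurable fun u : ℝ × (ℕ → ℝ) =>
    (ℓ * u.1, fun i : Fin n => N.obs (ℓ * u.1) u.2 i) :=
  (measurable_fst.const_mul ℓ).prodMk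
    (measurable_pi_lambda _ fun i => N.measurable_obs_scaled ℓ i)

instance (ℓ : ℝ) (n : ℕ) : IsProbabilityMeasure (N.joint ℓ n) :=
  Measure.isProbabilityMeasure_map (N.measurable_joint ℓ n).aemeasurable

theorem lintegral_joint (ℓ : ℝ) (n : ℕ) {F : ℝ × (Fin n → ℝ) → ℝ≥0∞} (hF : Measurable F) :
    ∫⁻ p, F p ∂N.joint ℓ n =
      ∫⁻ u, ∫⁻ ξ, F (ℓ * u, fun i : Fin n => N.obs (ℓ * u) ξ i) ∂gaussianNoise
        ∂gaussianReal 0 1 := by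
  rw [joint, lintegral_map hF (N.measurable_joint ℓ n), lintegral_prod]
  exact (hF.comp (N.measurable_joint ℓ n)).aemeasurable

/-- The first `n` observations, hence the next precision, depend only on the parameter and the first
`n` noise variables, so the next noise variable is independent of them. -/
theorem lintegral_joint_succ (ℓ : ℝ) (n : ℕ) {F : ℝ × (Fin (n + 1) → ℝ) → ℝ≥0∞}
    (hF : Measurable F) :
    ∫⁻ p, F p ∂N.joint ℓ (n + 1) =
      ∫⁻ p, ∫⁻ t, F (p.1, Fin.snoc p.2 (p.1 + (N.prec n p.2 : ℝ) * t)) ∂gaussianReal 0 1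
        ∂N.joint ℓ n := by
  have hp : Measurable fun y => (N.prec n y : ℝ) := (N.measurable_prec n).coe_nnreal_real
  have hG : Measurable fun q : (ℝ × (Fin n → ℝ)) × ℝ =>
      F (q.1.1, Fin.snoc q.1.2 (q.1.1 + (N.prec n q.1.2 : ℝ) * q.2)) := by
    refine hF.comp (Measurable.prodMk (by fun_prop)
      (measurable_finSnoc.comp (Measurable.prodMk (by fun_prop) ?_)))
    exact (measurable_fst.comp measurable_fst).add
      ((hp.comp (measurable_snd.comp measurable_fst)).mul measurable_snd)
  rw [lintegral_joint N ℓ _ hF, lintegral_joint N ℓ _ hG.lintegral_prod_right']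
  refine lintegral_congr fun u => ?_
  set f := ℓ * u
  -- The observations as a function of the first `n` noises alone; the padding value `0` is never
  -- read.
  let Y : (Fin n → ℝ) → Fin n → ℝ := fun w i =>
    N.obs f (fun k => if h : k < n then w ⟨k, h⟩ else 0) i
  have hY : ∀ ξ : ℕ → ℝ, Y (fun i => ξ i) = fun i : Fin n => N.obs f ξ i := by
    intro ξ
    funext i
    refine N.obs_congr f _ fun k hk => ?_
    rw [dif_pos (hk.trans_lt i.2)]
  have hYm : Measurable Y := by
    refine measurable_pi_lambda _ fun i => ?_
    refine (N.measurable_obs i).comp (measurable_const.prodMk (measurable_pi_lambda _ fun k => ?_))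
    change Measurable fun w : Fin n → ℝ => if h : k < n then w ⟨k, h⟩ else 0
    by_cases h : k < n
    · exact (funext fun w => dif_pos h :
        (fun w : Fin n → ℝ => if h : k < n then w ⟨k, h⟩ else 0) = fun w => w ⟨k, h⟩) ▸
        measurable_pi_apply _
    · exact (funext fun w => dif_neg h :
        (fun w : Fin n → ℝ => if h : k < n then w ⟨k, h⟩ else 0) = fun _ => 0) ▸
        measurable_const
  have h := lintegral_infinitePi_succ n
    (fun q => F (f, Fin.snoc (Y q.1) (f + (N.prec n (Y q.1) : ℝ) * q.2)))
    (hG.comp (f := fun q : (Fin n → ℝ) × ℝ => ((f, Y q.1), q.2)) (by fun_prop))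
  simp only [hY] at h
  rw [← h]
  refine lintegral_congr fun ξ => ?_
  congr 2
  funext i
  induction i using Fin.lastCases with
  | last => simp only [Fin.snoc_last, Fin.val_last]; rw [obs]
  | cast i => simp

/-- Induction on one-observation updates: given the past, the next precision is a constant, so
adaptivity is harmless. The sign of `r` is irrelevant; only `r²` is determined. -/
theorem exists_posterior {ℓ : ℝ} (n : ℕ) :
    ∃ m r : (Fin n → ℝ) → ℝ, Measurable m ∧ Measurable r ∧
      (∀ y, (ENNReal.ofReal (r y ^ 2))⁻¹ = (ENNReal.ofReal (ℓ ^ 2))⁻¹ + N.information ⟨n, y⟩) ∧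
      ∀ F : ℝ × (Fin n → ℝ) → ℝ≥0∞, Measurable F →
        ∫⁻ p, F p ∂N.joint ℓ n =
          ∫⁻ p, ∫⁻ z, F (m p.2 + r p.2 * z, p.2) ∂gaussianReal 0 1 ∂N.joint ℓ n := by
  induction n with
  | zero =>
    refine ⟨fun _ => 0, fun _ => ℓ, by fun_prop, by fun_prop, fun y => ?_, fun F hF => ?_⟩
    · simp [information, pathSum]
    · rw [lintegral_joint N ℓ 0 hF]
      have h0 : ∀ y : Fin 0 → ℝ, y = 0 := fun y => Subsingleton.elim _ _
      have hF0 : Measurable fun p : ℝ × (Fin 0 → ℝ) =>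
          ∫⁻ z, F (0 + ℓ * z, p.2) ∂gaussianReal 0 1 :=
        Measurable.lintegral_prod_right' (f := fun q : (ℝ × (Fin 0 → ℝ)) × ℝ =>
          F (0 + ℓ * q.2, q.1.2)) (hF.comp (by fun_prop))
      rw [lintegral_joint N ℓ 0 hF0]
      simp only [h0 (fun i => _), lintegral_const, measure_univ, mul_one, zero_add]
  | succ n ih =>
    obtain ⟨m, r, hm, hr, hV, hpost⟩ := ih
    have hp : Measurable fun y => (N.prec n y : ℝ) := (N.measurable_prec n).coe_nnreal_real
    obtain ⟨m', hm', hpost'⟩ := posterior_step (N.joint ℓ n) (N.joint ℓ (n + 1))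
      (fun y => (N.prec n y : ℝ)) m r hp hm hr (fun F hF => N.lintegral_joint_succ ℓ n hF) hpost
    have hi := measurable_finInit (n := n)
    have ha : Measurable fun y => Complex.arg ⟨(N.prec n y : ℝ), r y⟩ :=
      Complex.measurable_arg.comp
        (Complex.measurableEquivRealProd.symm.measurable.comp (hp.prodMk hr))
    refine ⟨m', fun y => r (Fin.init y) *
      Real.cos (Complex.arg ⟨N.prec n (Fin.init y), r (Fin.init y)⟩), hm', ?_, fun y => ?_, hpost'⟩
    · exact (hr.comp hi).mul (Real.measurable_cos.comp (ha.comp hi))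
    · rw [inv_ofReal_mul_cos_arg_sq, hV, information, pathSum_succ, add_assoc,
        ENNReal.ofReal_pow (NNReal.coe_nonneg _), ENNReal.ofReal_coe_nnreal]

end AdaptiveInfo

/-! ### Bayes risk and Bayes cost under a normal prior. -/

theorem CostFunction.measurable (c : CostFunction) (d : ℕ+) : Measurable fun σ => c σ d :=
  (c.antitone_prec d).measurable

theorem lintegral_sq_gaussianReal (a r : ℝ) :
    ∫⁻ z, ENNReal.ofReal ((a + r * z) ^ 2) ∂gaussianReal 0 1 = ENNReal.ofReal (a ^ 2 + r ^ 2) := by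
  have h1 : Integrable (fun z : ℝ => z) (gaussianReal 0 1) :=
    (memLp_id_gaussianReal 1).integrable (by simp)
  have hL2 : MemLp (fun z : ℝ => z) 2 (gaussianReal 0 1) := memLp_id_gaussianReal 2
  have h2 : Integrable (fun z : ℝ => z ^ 2) (gaussianReal 0 1) := hL2.integrable_sq
  have hv : ∫ z, z ^ 2 ∂gaussianReal 0 1 = 1 := by
    have h := variance_fun_id_gaussianReal (μ := 0) (v := 1)
    rw [variance_of_integral_eq_zero (X := fun x : ℝ => x) measurable_id.aemeasurable (by simp)] at h
    simpa using h
  have he : ∀ z : ℝ, (a + r * z) ^ 2 = a ^ 2 + 2 * a * r * z + r ^ 2 * z ^ 2 := fun z => by ring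
  simp only [he]
  have hi : Integrable (fun z : ℝ => a ^ 2 + 2 * a * r * z) (gaussianReal 0 1) :=
    (integrable_const _).add (h1.const_mul _)
  have hi2 : Integrable (fun z : ℝ => a ^ 2 + 2 * a * r * z + r ^ 2 * z ^ 2) (gaussianReal 0 1) :=
    hi.add (h2.const_mul _)
  rw [← ofReal_integral_eq_lintegral_ofReal hi2
    (Eventually.of_forall fun z => (sq_nonneg (a + r * z)).trans_eq (he z)),
    integral_add hi (h2.const_mul _), integral_add (integrable_const _) (h1.const_mul _),
    integral_const_mul, integral_const_mul, hv]
  simp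

namespace AdaptiveInfo

variable (N : AdaptiveInfo)

theorem lintegral_law (f : ℝ) {G : FinSeq → ℝ≥0∞} (hG : Measurable G) :
    ∫⁻ y, G y ∂N.law f = ∫⁻ ξ, G (N.stopped (N.obs f ξ)) ∂gaussianNoise :=
  lintegral_map hG (N.measurable_stopped_obs f)

theorem measurable_bayes (ℓ : ℝ) : Measurable fun u : ℝ × (ℕ → ℝ) =>
    N.stopped (N.obs (ℓ * u.1) u.2) :=
  N.measurable_stopped.comp (measurable_pi_lambda _ fun i => N.measurable_obs_scaled ℓ i)

/-- Stopping after `n` observations is an event in those `n` observations, so splitting by length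
reduces stopped runs to the fixed-length joint laws. -/
theorem lintegral_stopped (ℓ : ℝ) {H : ℝ × FinSeq → ℝ≥0∞}
    (hH : ∀ n, Measurable fun p : ℝ × (Fin n → ℝ) => H (p.1, ⟨n, p.2⟩)) :
    ∫⁻ u, H (ℓ * u.1, N.stopped (N.obs (ℓ * u.1) u.2)) ∂(gaussianReal 0 1).prod gaussianNoise =
      ∑' n, ∫⁻ p, {y : Fin n → ℝ | (⟨n, y⟩ : FinSeq) ∈ N.range}.indicator 1 p.2 *
        H (p.1, ⟨n, p.2⟩) ∂N.joint ℓ n := by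
  classical
  have hR : ∀ n, Measurable fun p : ℝ × (Fin n → ℝ) =>
      {y : Fin n → ℝ | (⟨n, y⟩ : FinSeq) ∈ N.range}.indicator (1 : (Fin n → ℝ) → ℝ≥0∞) p.2 *
        H (p.1, ⟨n, p.2⟩) := fun n =>
    ((measurable_one.indicator (measurable_finSeqMk n N.measurableSet_range)).comp
      measurable_snd).mul (hH n)
  have : ∀ n, ∫⁻ p, {y : Fin n → ℝ | (⟨n, y⟩ : FinSeq) ∈ N.range}.indicator 1 p.2 *
        H (p.1, ⟨n, p.2⟩) ∂N.joint ℓ n = _ :=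
    fun n => lintegral_map (hR n) (N.measurable_joint ℓ n)
  simp only [this]
  refine Eq.trans ?_ (lintegral_tsum fun n =>
    ((hR n).comp (N.measurable_joint ℓ n)).aemeasurable)
  refine lintegral_congr fun u => ?_
  rw [tsum_eq_single (N.length (N.obs (ℓ * u.1) u.2))]
  · rw [indicator_of_mem]
    · simp only [Pi.one_apply, one_mul]; rfl
    · exact N.length_mem _
  · intro n hn
    rw [indicator_of_notMem, zero_mul]
    exact fun h => hn ((N.length_eq_iff _ _).2 h).symm

/-- The posterior variance of the parameter, when its prior variance is `ℓ ^ 2`. -/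
noncomputable def posteriorVar (ℓ : ℝ) (y : FinSeq) : ℝ≥0∞ :=
  ((ENNReal.ofReal (ℓ ^ 2))⁻¹ + N.information y)⁻¹

theorem measurable_posteriorVar (ℓ : ℝ) : Measurable (N.posteriorVar ℓ) :=
  (measurable_const.add N.measurable_information).inv

/-- The Bayes risk is at least the expected posterior variance. -/
theorem lintegral_posteriorVar_le (ℓ : ℝ) {Φ : FinSeq → ℝ} (hΦ : Measurable Φ) :
    ∫⁻ u, N.posteriorVar ℓ (N.stopped (N.obs (ℓ * u.1) u.2))
        ∂(gaussianReal 0 1).prod gaussianNoise ≤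
      ∫⁻ u, ENNReal.ofReal ((ℓ * u.1 - Φ (N.stopped (N.obs (ℓ * u.1) u.2))) ^ 2)
        ∂(gaussianReal 0 1).prod gaussianNoise := by
  have hV : ∀ n, Measurable fun p : ℝ × (Fin n → ℝ) => N.posteriorVar ℓ ⟨n, p.2⟩ := fun n =>
    (N.measurable_posteriorVar ℓ).comp ((measurable_finSeqMk n).comp measurable_snd)
  have hΦn : ∀ n, Measurable fun y : Fin n → ℝ => Φ ⟨n, y⟩ := fun n =>
    hΦ.comp (measurable_finSeqMk n)
  have hL : ∀ n, Measurable fun p : ℝ × (Fin n → ℝ) =>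
      ENNReal.ofReal ((p.1 - Φ ⟨n, p.2⟩) ^ 2) := fun n =>
    ((measurable_fst.sub ((hΦn n).comp measurable_snd)).pow_const 2).ennreal_ofReal
  rw [N.lintegral_stopped ℓ (H := fun p => N.posteriorVar ℓ p.2) hV,
    N.lintegral_stopped ℓ (H := fun p => ENNReal.ofReal ((p.1 - Φ p.2) ^ 2)) hL]
  refine ENNReal.tsum_le_tsum fun n => ?_
  obtain ⟨m, r, hm, hr, hrV, hpost⟩ := N.exists_posterior (ℓ := ℓ) n
  have hI : Measurable fun p : ℝ × (Fin n → ℝ) =>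
      {y : Fin n → ℝ | (⟨n, y⟩ : FinSeq) ∈ N.range}.indicator (1 : (Fin n → ℝ) → ℝ≥0∞) p.2 :=
    (measurable_one.indicator (measurable_finSeqMk n N.measurableSet_range)).comp measurable_snd
  -- Resample the parameter from its posterior: the conditional mean square error is `(m - Φ)² + r²
  -- ≥ r²`.
  refine le_of_le_of_eq ?_ (hpost _ (hI.mul (hL n))).symm
  refine lintegral_mono fun p => ?_
  simp only [Pi.mul_apply]
  rw [lintegral_const_mul _ (by fun_prop)]
  gcongr
  have he : ∀ z, m p.2 + r p.2 * z - Φ ⟨n, p.2⟩ = (m p.2 - Φ ⟨n, p.2⟩) + r p.2 * z :=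
    fun z => by ring
  simp only [he]
  rw [lintegral_sq_gaussianReal, posteriorVar, ← hrV, inv_inv]
  exact ENNReal.ofReal_le_ofReal (by nlinarith [sq_nonneg (m p.2 - Φ ⟨n, p.2⟩)])

theorem error_le_iff (Φ : FinSeq → ℝ) (σ : ℝ≥0) :
    N.error Φ ≤ σ ↔ ∀ f, ∫⁻ y, ENNReal.ofReal ((f - Φ y) ^ 2) ∂N.law f ≤ (σ : ℝ≥0∞) ^ 2 := by
  rw [error, iSup_le_iff]
  refine forall_congr' fun f => ?_
  rw [one_div, ENNReal.rpow_inv_le_iff two_pos, ENNReal.rpow_two]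

/-- The distribution of information when the parameter is centered Gaussian with standard deviation
`ℓ`. -/
noncomputable def bayesLaw (ℓ : ℝ) : Measure FinSeq :=
  ((gaussianReal 0 1).prod gaussianNoise).map fun u => N.stopped (N.obs (ℓ * u.1) u.2)

instance (ℓ : ℝ) : IsProbabilityMeasure (N.bayesLaw ℓ) :=
  Measure.isProbabilityMeasure_map (N.measurable_bayes ℓ).aemeasurable

theorem lintegral_bayesLaw_pathCost_le (ℓ : ℝ) (c : CostFunction) (d : ℕ+) :
    ∫⁻ y, N.pathCost c d y ∂N.bayesLaw ℓ ≤ N.cost c d := by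
  have hc : Measurable (N.pathCost c d) := N.measurable_pathSum (c.measurable d)
  rw [bayesLaw, lintegral_map hc (N.measurable_bayes ℓ)]
  refine (lintegral_prod_le _).trans ?_
  calc _ ≤ ∫⁻ _, N.cost c d ∂gaussianReal 0 1 := lintegral_mono fun u => by
        simp only
        rw [← N.lintegral_law (ℓ * u) hc]
        exact le_iSup (fun f => ∫⁻ y, N.pathCost c d y ∂N.law f) (ℓ * u)
    _ = _ := by simp

theorem lintegral_bayesLaw_posteriorVar_le (ℓ : ℝ) {Φ : FinSeq → ℝ} (hΦ : Measurable Φ) {σ : ℝ≥0}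
    (hσ : N.error Φ ≤ σ) : ∫⁻ y, N.posteriorVar ℓ y ∂N.bayesLaw ℓ ≤ (σ : ℝ≥0∞) ^ 2 := by
  rw [error_le_iff] at hσ
  rw [bayesLaw, lintegral_map (N.measurable_posteriorVar ℓ) (N.measurable_bayes ℓ)]
  refine (N.lintegral_posteriorVar_le ℓ hΦ).trans ((lintegral_prod_le _).trans ?_)
  calc _ ≤ ∫⁻ _, (σ : ℝ≥0∞) ^ 2 ∂gaussianReal 0 1 := lintegral_mono fun u => by
        simp only
        rw [← N.lintegral_law (ℓ * u) (G := fun y => ENNReal.ofReal ((ℓ * u - Φ y) ^ 2))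
          (by fun_prop)]
        exact hσ _
    _ = _ := by simp

/-- If the empty sequence is a value of information, every run stops at once and the posterior
variance stays `ℓ² > σ²`. This secures `S > 0`, as `h₁` is controlled only on `(0, ∞)`. -/
theorem ae_bayesLaw_length_pos {ℓ : ℝ} {Φ : FinSeq → ℝ} (hΦ : Measurable Φ) {σ : ℝ≥0}
    (hσ : N.error Φ ≤ σ) (hℓ : σ < ℓ) : ∀ᵐ y ∂N.bayesLaw ℓ, 0 < y.1 := by
  by_cases h0 : ∃ w, (⟨0, w⟩ : FinSeq) ∈ N.range
  · exfalso
    obtain ⟨w, hw⟩ := h0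
    have hst : ∀ y, N.stopped y = ⟨0, w⟩ := fun y => by
      have : N.length y = 0 := (N.length_eq_iff y 0).2 (by rwa [Subsingleton.elim (fun i : Fin 0 => y i) w])
      unfold stopped
      rw [this]
      congr
      exact Subsingleton.elim _ _
    have h := N.lintegral_bayesLaw_posteriorVar_le ℓ hΦ hσ
    rw [bayesLaw, lintegral_map (N.measurable_posteriorVar ℓ) (N.measurable_bayes ℓ)] at h
    simp only [hst, lintegral_const, measure_univ, mul_one] at h
    have h2 : N.posteriorVar ℓ ⟨0, w⟩ = ENNReal.ofReal (ℓ ^ 2) := by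
      simp [posteriorVar, information, pathSum]
    rw [h2, ← ENNReal.ofReal_coe_nnreal, ← ENNReal.ofReal_pow (NNReal.coe_nonneg _),
      ENNReal.ofReal_le_ofReal_iff (by positivity)] at h
    exact absurd h (not_le.2 (pow_lt_pow_left₀ hℓ (NNReal.coe_nonneg _) (by norm_num)))
  · rw [bayesLaw, ae_map_iff (N.measurable_bayes ℓ).aemeasurable]
    · refine Eventually.of_forall fun u => Nat.pos_of_ne_zero fun h => h0 ?_
      have := N.length_mem (N.obs (ℓ * u.1) u.2)
      exact ⟨_, (N.length_eq_iff (N.obs (ℓ * u.1) u.2) 0).1 h⟩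
    · exact (measurable_of_comp_finSeqMk (g := fun y : FinSeq => y.1) fun n => measurable_const)
        (measurableSet_Ioi (a := 0))

end AdaptiveInfo

/-! ### Upper bounds by averaging repeated observations. -/

theorem lintegral_sq_sum_gaussianNoise (n : ℕ) :
    ∫⁻ ξ, ENNReal.ofReal ((∑ i : Fin n, ξ i) ^ 2) ∂gaussianNoise = n := by
  induction n with
  | zero => simp
  | succ n ih =>
    have h := lintegral_infinitePi_succ n
      (fun q => ENNReal.ofReal ((∑ i : Fin n, q.1 i + 1 * q.2) ^ 2)) (by fun_prop)
    simp only [lintegral_sq_gaussianReal] at h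
    simp only [one_mul] at h
    simp only [Fin.sum_univ_castSucc, Fin.val_castSucc, Fin.val_last]
    rw [h]
    simp only [ENNReal.ofReal_add (sq_nonneg _) (sq_nonneg _)]
    rw [lintegral_add_right _ measurable_const, ih]
    simp

namespace AdaptiveInfo

/-- Nonadaptive information consisting of `n` observations with the same precision. -/
def repeated (n : ℕ) (σ₀ : ℝ≥0) : AdaptiveInfo where
  prec _ _ := σ₀
  measurable_prec _ := measurable_const
  range := {y | y.1 = n}
  measurableSet_range :=
    (measurable_of_comp_finSeqMk (g := fun y : FinSeq => y.1) fun _ => measurable_const)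
      (measurableSet_singleton n)
  existsUnique_length _ := ⟨n, rfl, fun _ h => h⟩

theorem obs_repeated (n : ℕ) (σ₀ : ℝ≥0) (f : ℝ) (ξ : ℕ → ℝ) (i : ℕ) :
    (repeated n σ₀).obs f ξ i = f + σ₀ * ξ i := by
  rw [obs]
  rfl

theorem stopped_repeated (n : ℕ) (σ₀ : ℝ≥0) (y : ℕ → ℝ) :
    (repeated n σ₀).stopped y = ⟨n, fun i => y i⟩ := by
  have h : (repeated n σ₀).length y = n := (length_eq_iff _ y n).2 rfl
  unfold stopped
  rw [h]

theorem cost_repeated_le (n : ℕ) (σ₀ : ℝ≥0) (c : CostFunction) (d : ℕ+) :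
    (repeated n σ₀).cost c d ≤ n * c σ₀ d := by
  refine iSup_le fun f => ?_
  rw [pathCost_eq_pathSum, lintegral_law _ _ (measurable_pathSum _ (c.measurable d))]
  simp only [stopped_repeated]
  refine (lintegral_mono (g := fun _ => n * c σ₀ d) fun ξ => ?_).trans (by simp)
  simp [pathSum, repeated]

theorem error_repeated_le {n : ℕ} (hn : 0 < n) {σ₀ σ : ℝ≥0} (h : σ₀ ^ 2 ≤ n * σ ^ 2) :
    (repeated n σ₀).error (fun y => (∑ i : Fin y.1, y.2 i) / n) ≤ σ := by
  have hm : Measurable fun y : FinSeq => (∑ i : Fin y.1, y.2 i) / (n : ℝ) :=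
    measurable_of_comp_finSeqMk fun k => by
      change Measurable fun y : Fin k → ℝ => (∑ i : Fin k, y i) / (n : ℝ)
      fun_prop
  generalize hΦ : (fun y : FinSeq => (∑ i : Fin y.1, y.2 i) / (n : ℝ)) = Φ at hm ⊢
  rw [error_le_iff]
  intro f
  have hst : ∀ ξ, Φ ((repeated n σ₀).stopped ((repeated n σ₀).obs f ξ)) =
      (∑ i : Fin n, (f + σ₀ * ξ i)) / n := fun ξ => by
    rw [stopped_repeated]
    simp only [← hΦ, obs_repeated]
  rw [lintegral_law _ _ (G := fun y => ENNReal.ofReal ((f - Φ y) ^ 2)) (by fun_prop)]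
  simp only [hst]
  have hn' : (n : ℝ) ≠ 0 := by positivity
  have he : ∀ ξ : ℕ → ℝ, ENNReal.ofReal ((f - (∑ i : Fin n, (f + σ₀ * ξ i)) / n) ^ 2) =
      ENNReal.ofReal ((σ₀ / n) ^ 2) * ENNReal.ofReal ((∑ i : Fin n, ξ i) ^ 2) := by
    intro ξ
    rw [← ENNReal.ofReal_mul (sq_nonneg _), Finset.sum_add_distrib, ← Finset.mul_sum]
    congr 1
    simp only [Finset.sum_const, Finset.card_univ, Fintype.card_fin, nsmul_eq_mul]
    field_simp
    ring
  simp only [he]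
  rw [lintegral_const_mul _ (by fun_prop), lintegral_sq_sum_gaussianNoise,
    ← ENNReal.ofReal_natCast, ← ENNReal.ofReal_mul (sq_nonneg _), ← ENNReal.ofReal_coe_nnreal,
    ← ENNReal.ofReal_pow (NNReal.coe_nonneg _)]
  refine ENNReal.ofReal_le_ofReal ?_
  have h' : (σ₀ : ℝ) ^ 2 ≤ n * (σ : ℝ) ^ 2 := by exact_mod_cast h
  rw [div_pow, sq (n : ℝ), div_mul_eq_mul_div, mul_div_mul_right _ _ hn', div_le_iff₀ (by positivity)]
  linarith

end AdaptiveInfo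

theorem auxCost_le_mul (c : CostFunction) (d : ℕ+) {n : ℕ} (hn : 0 < n) {σ₀ σ : ℝ≥0}
    (h : σ₀ ^ 2 ≤ n * σ ^ 2) : auxCost c σ d ≤ n * c σ₀ d := by
  have hm : Measurable fun y : FinSeq => (∑ i : Fin y.1, y.2 i) / (n : ℝ) :=
    measurable_of_comp_finSeqMk fun k => by
      change Measurable fun y : Fin k → ℝ => (∑ i : Fin k, y i) / (n : ℝ)
      fun_prop
  refine le_trans (sInf_le ?_) (AdaptiveInfo.cost_repeated_le n σ₀ c d)
  exact ⟨_, _, hm, AdaptiveInfo.error_repeated_le hn h, rfl⟩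

theorem auxCost_le_ceil_mul (c : CostFunction) (d : ℕ+) {σ₀ σ : ℝ≥0} (hσ₀ : 0 < σ₀) (hσ : 0 < σ) :
    auxCost c σ d ≤ (⌈σ₀ ^ 2 / σ ^ 2⌉₊ : ℝ≥0∞) * c σ₀ d := by
  refine auxCost_le_mul c d (Nat.ceil_pos.2 (by positivity)) ?_
  rw [← div_le_iff₀ (by positivity)]
  exact Nat.le_ceil _

/-! ### Consequences of concavity of `h₁` and convexity of `h₂`. -/

namespace CostFunction

variable (c : CostFunction) (d : ℕ+)

theorem h₁_inv_sq (σ : ℝ≥0) : c.h₁ d (σ ^ 2)⁻¹ = c σ d := by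
  rw [h₁, one_div, inv_inv, NNReal.sqrt_sq]

theorem h₁_mono {x z : ℝ≥0} (hx : 0 < x) (h : x ≤ z) : c.h₁ d x ≤ c.h₁ d z :=
  c.antitone_prec d (NNReal.sqrt_le_sqrt.2 (by gcongr))

theorem h₂_antitone {lam v w : ℝ≥0} (h : v ≤ w) (hw : w < lam) : c.h₂ lam d w ≤ c.h₂ lam d v := by
  have : 0 < lam - w := tsub_pos_of_lt hw
  exact c.antitone_prec d (NNReal.sqrt_le_sqrt.2 (by gcongr))

variable {c d}

/-- For a nonnegative concave function, `h₁(x) / x` is non-increasing. As `0` lies outside the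
domain, `x` is written as `a z + (1 - a) ε` with `ε > 0`, for each `a < x / z`. -/
theorem div_mul_h₁_le (hc : ConcaveOn ℝ≥0 (Ioi 0) (c.h₁ d)) {x z : ℝ≥0} (hx : 0 < x) (h : x ≤ z) :
    ((x / z : ℝ≥0) : ℝ≥0∞) * c.h₁ d z ≤ c.h₁ d x := by
  have hz : 0 < z := hx.trans_le h
  refine ENNReal.mul_le_of_forall_lt fun a ha b hb => ?_
  lift a to ℝ≥0 using ha.ne_top
  have ha' : a < x / z := by exact_mod_cast ha
  have h1 : a * z < x := (lt_div_iff₀ hz).1 ha'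
  have ha1 : a < 1 := ha'.trans_le (div_le_one_of_le₀ h zero_le)
  have h1a : 0 < 1 - a := tsub_pos_of_lt ha1
  have hε : 0 < (x - a * z) / (1 - a) := div_pos (tsub_pos_of_lt h1) h1a
  have := hc.2 (mem_Ioi.2 hz) (mem_Ioi.2 hε) (zero_le : 0 ≤ a) (zero_le : 0 ≤ 1 - a)
    (add_tsub_cancel_of_le ha1.le)
  rw [smul_eq_mul, smul_eq_mul, mul_div_cancel₀ _ h1a.ne', add_tsub_cancel_of_le h1.le] at this
  calc (a : ℝ≥0∞) * b ≤ a * c.h₁ d z := by gcongr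
    _ = a • c.h₁ d z := rfl
    _ ≤ _ := le_self_add.trans this

/-- A non-increasing convex function lies above a line with nonpositive slope that touches it. -/
theorem exists_h₂_tangent {lam m : ℝ≥0} (hc : ConvexOn ℝ≥0 (Ioo 0 lam) (c.h₂ lam d))
    (hfin : ∀ v, 0 < v → v < lam → c.h₂ lam d v ≠ ∞) (hm : 0 < m) (hml : m < lam) :
    ∃ k : ℝ≥0, ∀ v, 0 < v → v < lam → c.h₂ lam d m + k * m ≤ c.h₂ lam d v + k * v := by
  set g : ℝ → ℝ := fun v => (c.h₂ lam d v.toNNReal).toReal with hg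
  have hfin' : ∀ v ∈ Ioo (0 : ℝ) lam, c.h₂ lam d v.toNNReal ≠ ∞ := fun v hv =>
    hfin _ (Real.toNNReal_pos.2 hv.1) ((Real.toNNReal_lt_iff_lt_coe hv.1.le).2 hv.2)
  have hgc : ConvexOn ℝ (Ioo (0 : ℝ) lam) g := by
    refine ⟨convex_Ioo _ _, fun x hx y hy a b ha hb hab => ?_⟩
    have h := hc.2 (x := x.toNNReal) (y := y.toNNReal)
      ⟨Real.toNNReal_pos.2 hx.1, (Real.toNNReal_lt_iff_lt_coe hx.1.le).2 hx.2⟩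
      ⟨Real.toNNReal_pos.2 hy.1, (Real.toNNReal_lt_iff_lt_coe hy.1.le).2 hy.2⟩
      (zero_le : 0 ≤ a.toNNReal) (zero_le : 0 ≤ b.toNNReal)
      (by rw [← Real.toNNReal_add ha hb, hab, Real.toNNReal_one])
    have e : a.toNNReal • x.toNNReal + b.toNNReal • y.toNNReal = (a • x + b • y).toNNReal := by
      simp only [smul_eq_mul]
      rw [Real.toNNReal_add (mul_nonneg ha hx.1.le) (mul_nonneg hb hy.1.le),
        Real.toNNReal_mul ha, Real.toNNReal_mul hb]
    rw [e] at h
    have hX : a.toNNReal • c.h₂ lam d x.toNNReal ≠ ∞ :=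
      ENNReal.mul_ne_top ENNReal.coe_ne_top (hfin' x hx)
    have hY : b.toNNReal • c.h₂ lam d y.toNNReal ≠ ∞ :=
      ENNReal.mul_ne_top ENNReal.coe_ne_top (hfin' y hy)
    have h2 := ENNReal.toReal_mono (ENNReal.add_ne_top.2 ⟨hX, hY⟩) h
    rw [ENNReal.toReal_add hX hY] at h2
    simp only [ENNReal.smul_def, smul_eq_mul] at h2 ⊢
    rw [ENNReal.toReal_mul, ENNReal.toReal_mul, ENNReal.coe_toReal, ENNReal.coe_toReal,
      Real.coe_toNNReal _ ha, Real.coe_toNNReal _ hb] at h2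
    exact h2
  have hmI : (m : ℝ) ∈ interior (Ioo (0 : ℝ) lam) := by
    rw [interior_Ioo]; exact ⟨by exact_mod_cast hm, by exact_mod_cast hml⟩
  -- The right derivative is a subgradient at the interior point `m`; it is nonpositive because `g`
  -- is non-increasing.
  set k := derivWithin g (Ioi (m : ℝ)) m with hk
  have hk0 : k ≤ 0 := by
    obtain ⟨w, hw1, hw2⟩ := exists_between hml
    have h := hgc.rightDeriv_le_slope_of_mem_interior hmI (y := w)
      ⟨by exact_mod_cast hm.trans hw1, by exact_mod_cast hw2⟩ (by exact_mod_cast hw1)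
    refine h.trans ?_
    rw [slope_def_field]
    refine div_nonpos_of_nonpos_of_nonneg (sub_nonpos.2 ?_)
      (sub_nonneg.2 (by exact_mod_cast hw1.le))
    simp only [hg, Real.toNNReal_coe]
    exact ENNReal.toReal_mono (hfin _ hm hml) (c.h₂_antitone d hw1.le hw2)
  have hline : ∀ v ∈ Ioo (0 : ℝ) lam, g m + k * (v - m) ≤ g v := by
    intro v hv
    rcases lt_trichotomy v m with h | h | h
    · have h1 := (hgc.slope_le_leftDeriv_of_mem_interior hv hmI h).trans
        (hgc.leftDeriv_le_rightDeriv_of_mem_interior hmI)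
      rw [slope_def_field, div_le_iff₀ (sub_pos.2 h)] at h1
      linarith
    · simp [h]
    · have h1 := hgc.rightDeriv_le_slope_of_mem_interior hmI hv h
      rw [slope_def_field, le_div_iff₀ (sub_pos.2 h)] at h1
      linarith
  -- The linear terms are put on both sides with coefficient `-k ≥ 0`, avoiding subtraction in `[0,
  -- ∞]`.
  refine ⟨(-k).toNNReal, fun v hv hvl => ?_⟩
  have h := hline v ⟨by exact_mod_cast hv, by exact_mod_cast hvl⟩
  simp only [hg, Real.toNNReal_coe] at h
  rw [← ENNReal.toReal_le_toReal (ENNReal.add_ne_top.2 ⟨hfin m hm hml, by finiteness⟩)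
    (ENNReal.add_ne_top.2 ⟨hfin v hv hvl, by finiteness⟩),
    ENNReal.toReal_add (hfin m hm hml) (by finiteness),
    ENNReal.toReal_add (hfin v hv hvl) (by finiteness)]
  simp only [ENNReal.toReal_mul, ENNReal.coe_toReal, Real.coe_toNNReal _ (neg_nonneg.2 hk0)]
  linarith

end CostFunction

/-! ### Lower bounds for the cost. -/

namespace AdaptiveInfo

variable (N : AdaptiveInfo) {c : CostFunction} {d : ℕ+}

theorem mul_information_le_pathCost {a : ℝ≥0∞} {y : FinSeq}
    (h : ∀ i : Fin y.1, a * ((N.prec i fun j : Fin i => y.2 (j.castLE i.2.le) : ℝ≥0∞) ^ 2)⁻¹ ≤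
      c (N.prec i fun j : Fin i => y.2 (j.castLE i.2.le)) d) :
    a * N.information y ≤ N.pathCost c d y := by
  rw [information, pathSum, Finset.mul_sum]
  exact Finset.sum_le_sum fun i _ => h i

theorem le_pathSum (g : ℝ≥0 → ℝ≥0∞) (y : FinSeq) (i : Fin y.1) :
    g (N.prec i fun j : Fin i => y.2 (j.castLE i.2.le)) ≤ N.pathSum g y :=
  Finset.single_le_sum (f := fun i : Fin y.1 => g (N.prec i fun j : Fin i =>
    y.2 (j.castLE i.2.le))) (fun _ _ => zero_le) (Finset.mem_univ i)

theorem cost_zero_le_pathCost {y : FinSeq} (h : N.information y = ∞) :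
    c 0 d ≤ N.pathCost c d y := by
  rw [information, pathSum] at h
  obtain ⟨i, -, hi⟩ := ENNReal.sum_eq_top.1 h
  have h0 : N.prec i (fun j : Fin i => y.2 (j.castLE i.2.le)) = 0 := by
    simpa using hi
  rw [← h0]
  exact N.le_pathSum (fun σ => c σ d) y i

theorem information_pos {y : FinSeq} (h : 0 < y.1) : 0 < N.information y :=
  (ENNReal.inv_pos.2 (by finiteness)).trans_le (N.le_pathSum _ y ⟨0, h⟩)

/-- Subadditivity: each `xᵢ = σᵢ⁻² ≤ S` satisfies `h₁(xᵢ) ≥ (xᵢ / S) h₁(S)`, and the `xᵢ` sum to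
`S`. -/
theorem h₁_information_le_pathCost (hc : ConcaveOn ℝ≥0 (Ioi 0) (c.h₁ d)) {y : FinSeq}
    (hy : 0 < y.1) {S : ℝ≥0} (hS : N.information y = S) : c.h₁ d S ≤ N.pathCost c d y := by
  have hS0 : 0 < S := by
    have := N.information_pos hy
    rw [hS] at this
    exact_mod_cast this
  have h := N.mul_information_le_pathCost (c := c) (d := d) (a := (S : ℝ≥0∞)⁻¹ * c.h₁ d S) (y := y)
    fun i => by
      set s := N.prec i fun j : Fin i => y.2 (j.castLE i.2.le) with hs
      have hle : ((s : ℝ≥0∞) ^ 2)⁻¹ ≤ S := by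
        rw [← hS]
        exact N.le_pathSum (fun σ => ((σ : ℝ≥0∞) ^ 2)⁻¹) y i
      have hs0 : s ≠ 0 := by
        rintro h0
        simp [h0] at hle
      have e : ((s : ℝ≥0∞) ^ 2)⁻¹ = (((s ^ 2)⁻¹ : ℝ≥0) : ℝ≥0∞) := by
        rw [ENNReal.coe_inv (by positivity), ENNReal.coe_pow]
      rw [e] at hle ⊢
      have := CostFunction.div_mul_h₁_le hc (x := (s ^ 2)⁻¹) (z := S) (by positivity)
        (by exact_mod_cast hle)
      rw [c.h₁_inv_sq, ENNReal.coe_div hS0.ne', div_eq_mul_inv] at this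
      calc _ = _ := by ring
        _ ≤ _ := this
  rw [hS, mul_right_comm, ENNReal.inv_mul_cancel (by exact_mod_cast hS0.ne') (by finiteness),
    one_mul] at h
  exact h

variable {N}

/-- Zero error forces zero posterior variance almost surely, hence infinite information, hence an
exact observation on almost every run. -/
theorem cost_zero_le_cost_of_error_le_zero {Φ : FinSeq → ℝ} (hΦ : Measurable Φ)
    (he : N.error Φ ≤ (0 : ℝ≥0)) : c 0 d ≤ N.cost c d := by
  have h := N.lintegral_bayesLaw_posteriorVar_le 1 hΦ he
  have h0 : ∫⁻ y, N.posteriorVar 1 y ∂N.bayesLaw 1 = 0 := by simpa using h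
  rw [lintegral_eq_zero_iff (N.measurable_posteriorVar 1)] at h0
  refine le_trans ?_ (N.lintegral_bayesLaw_pathCost_le 1 c d)
  calc c 0 d = ∫⁻ _, c 0 d ∂N.bayesLaw 1 := by simp
    _ ≤ _ := by
      refine lintegral_mono_ae (h0.mono fun y hy => N.cost_zero_le_pathCost ?_)
      simpa [posteriorVar] using hy

/-- Concavity and monotonicity spread one infinite value of `h₁` over all of `(0, ∞)`. Removing this
case allows real-valued convex analysis for `h₂`. -/
theorem cost_eq_top (hc : ConcaveOn ℝ≥0 (Ioi 0) (c.h₁ d)) {z : ℝ≥0} (hz : 0 < z)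
    (hinf : c.h₁ d z = ∞) {Φ : FinSeq → ℝ} (hΦ : Measurable Φ) {σ : ℝ≥0}
    (he : N.error Φ ≤ σ) : N.cost c d = ∞ := by
  have hall : ∀ x, 0 < x → c.h₁ d x = ∞ := fun x hx => by
    rcases le_total x z with h | h
    · have h1 := CostFunction.div_mul_h₁_le hc hx h
      rw [hinf, ENNReal.mul_top (by exact_mod_cast (div_pos hx hz).ne')] at h1
      exact top_le_iff.1 h1
    · exact top_le_iff.1 (hinf.symm.le.trans (c.h₁_mono d hz h))
  have hpos := N.ae_bayesLaw_length_pos hΦ he (ℓ := σ + 1) (by linarith)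
  refine top_le_iff.1 (le_trans ?_ (N.lintegral_bayesLaw_pathCost_le (σ + 1) c d))
  calc (∞ : ℝ≥0∞) = ∫⁻ _, ∞ ∂N.bayesLaw (σ + 1) := by simp
    _ ≤ _ := by
      refine lintegral_mono_ae (hpos.mono fun y hy => ?_)
      by_cases hS : N.information y = ∞
      · refine le_trans ?_ (N.cost_zero_le_pathCost hS)
        rw [← hall 1 one_pos]
        exact c.antitone_prec d zero_le
      · lift N.information y to ℝ≥0 using hS with S hS'
        have h0 := N.information_pos hy
        rw [← hS'] at h0
        rw [← hall S (by exact_mod_cast h0)]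
        exact N.h₁_information_le_pathCost hc hy hS'.symm

theorem h₂_le_cost (hc : ConcaveOn ℝ≥0 (Ioi 0) (c.h₁ d)) (hfin : ∀ x, 0 < x → c.h₁ d x ≠ ∞)
    {lam σ : ℝ≥0} (hσ : 0 < σ) (hlam : σ ^ 2 < lam)
    (hconv : ConvexOn ℝ≥0 (Ioo 0 lam) (c.h₂ lam d)) {Φ : FinSeq → ℝ} (hΦ : Measurable Φ)
    (he : N.error Φ ≤ σ) : c.h₂ lam d (σ ^ 2) ≤ N.cost c d := by
  have hl : 0 < lam := zero_le.trans_lt hlam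
  have hfin2 : ∀ v, 0 < v → v < lam → c.h₂ lam d v ≠ ∞ := fun v hv hvl => by
    have h : 0 < lam * v / (lam - v) := div_pos (mul_pos hl hv) (tsub_pos_of_lt hvl)
    have := hfin (lam * v / (lam - v))⁻¹ (by positivity)
    rwa [CostFunction.h₁, one_div, inv_inv] at this
  obtain ⟨k, hk⟩ := CostFunction.exists_h₂_tangent hconv hfin2 (by positivity) hlam
  obtain ⟨ℓ, hℓ⟩ : ∃ ℓ : ℝ, ℓ = ((NNReal.sqrt lam : ℝ≥0) : ℝ) := ⟨_, rfl⟩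
  have hℓ2 : ENNReal.ofReal (ℓ ^ 2) = lam := by
    rw [hℓ, ← NNReal.coe_pow, NNReal.sq_sqrt, ENNReal.ofReal_coe_nnreal]
  have hσℓ : (σ : ℝ) < ℓ := by
    rw [hℓ]
    rw [Real.coe_sqrt]
    exact Real.lt_sqrt_of_sq_lt (by exact_mod_cast hlam)
  have hpt : ∀ᵐ y ∂N.bayesLaw ℓ,
      c.h₂ lam d (σ ^ 2) + k * (σ ^ 2 : ℝ≥0) ≤ N.pathCost c d y + k * N.posteriorVar ℓ y := by
    filter_upwards [N.ae_bayesLaw_length_pos hΦ he hσℓ] with y hy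
    rw [posteriorVar, hℓ2]
    by_cases hS : N.information y = ∞
    · have h0 : ∀ v, 0 < v → v < lam →
          c.h₂ lam d (σ ^ 2) + k * (σ ^ 2 : ℝ≥0) ≤ N.pathCost c d y + k * v := fun v hv hvl => by
        refine (hk v hv hvl).trans ?_
        gcongr
        exact (c.antitone_prec d zero_le).trans (N.cost_zero_le_pathCost hS)
      -- An exact observation gives `V = 0`, outside the interval of convexity, so the tangent
      -- inequality is passed to the limit `v → 0⁺`.
      rw [hS, add_top, ENNReal.inv_top, mul_zero, add_zero]
      have ht : Tendsto (fun v : ℝ≥0 => N.pathCost c d y + k * (v : ℝ≥0∞)) (nhdsWithin 0 (Ioi 0))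
          (nhds (N.pathCost c d y + k * ((0 : ℝ≥0) : ℝ≥0∞))) := by
        refine Tendsto.mono_left (Continuous.tendsto ?_ 0) nhdsWithin_le_nhds
        exact continuous_const.add
          ((ENNReal.continuous_const_mul ENNReal.coe_ne_top).comp ENNReal.continuous_coe)
      have hev : ∀ᶠ v : ℝ≥0 in nhdsWithin 0 (Ioi 0),
          c.h₂ lam d (σ ^ 2) + k * (σ ^ 2 : ℝ≥0) ≤ N.pathCost c d y + k * (v : ℝ≥0∞) := by
        filter_upwards [Ioo_mem_nhdsGT hl] with v hv
        exact h0 v hv.1 hv.2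
      simpa using ge_of_tendsto ht hev
    · lift N.information y to ℝ≥0 using hS with S hS'
      have hS0 : 0 < S := by
        have := N.information_pos hy
        rw [← hS'] at this
        exact_mod_cast this
      have hvl : (lam⁻¹ + S)⁻¹ < lam := by
        rw [inv_lt_comm₀ (by positivity) hl]
        exact lt_add_of_pos_right _ hS0
      have h := hk (lam⁻¹ + S)⁻¹ (by positivity) hvl
      rw [← ENNReal.coe_inv hl.ne', ← ENNReal.coe_add, ← ENNReal.coe_inv (by positivity)]
      refine h.trans ?_
      gcongr
      refine le_trans (le_of_eq ?_) (N.h₁_information_le_pathCost hc hy hS'.symm)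
      rw [CostFunction.h₁, CostFunction.h₂]
      -- For `V = (λ⁻¹ + S)⁻¹` one has `λ V / (λ - V) = S⁻¹`, so `h₂` at `V` is `h₁` at `S`.
      congr 2
      rw [← NNReal.coe_inj]
      push_cast [hvl.le]
      have h1 : (0 : ℝ) < lam := by exact_mod_cast hl
      have h2 : (0 : ℝ) < S := by exact_mod_cast hS0
      have h4 : ((lam : ℝ)⁻¹ + S)⁻¹ = lam / (1 + lam * S) := by field_simp
      have h5 : (lam : ℝ) - lam / (1 + lam * S) = lam * (lam * S) / (1 + lam * S) := by
        field_simp; ring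
      rw [h4, h5]
      field_simp
  have hint := lintegral_mono_ae hpt
  rw [lintegral_const, measure_univ, mul_one,
    lintegral_add_right _ ((N.measurable_posteriorVar ℓ).const_mul _),
    lintegral_const_mul _ (N.measurable_posteriorVar ℓ)] at hint
  have hV := N.lintegral_bayesLaw_posteriorVar_le ℓ hΦ he
  have h2 : c.h₂ lam d (σ ^ 2) + k * (σ ^ 2 : ℝ≥0) ≤ N.cost c d + k * (σ ^ 2 : ℝ≥0) := by
    refine hint.trans ?_
    rw [ENNReal.coe_pow]
    gcongr
    exact N.lintegral_bayesLaw_pathCost_le ℓ c d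
  exact (ENNReal.add_le_add_iff_right (by finiteness)).1 h2

theorem le_cost_of_concave_of_convex (hc : ConcaveOn ℝ≥0 (Ioi 0) (c.h₁ d))
    (hconv : ∀ᶠ lam : ℝ≥0 in atTop, ConvexOn ℝ≥0 (Ioo 0 lam) (c.h₂ lam d))
    {Φ : FinSeq → ℝ} (hΦ : Measurable Φ) {σ : ℝ≥0} (he : N.error Φ ≤ σ) :
    c σ d ≤ N.cost c d := by
  rcases eq_zero_or_pos σ with rfl | hσ
  · exact cost_zero_le_cost_of_error_le_zero hΦ he
  by_cases hfin : ∀ x, 0 < x → c.h₁ d x ≠ ∞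
  swap
  · push Not at hfin
    obtain ⟨z, hz, hinf⟩ := hfin
    rw [cost_eq_top hc hz hinf hΦ he]
    exact le_top
  rw [← one_mul (c σ d)]
  refine ENNReal.mul_le_of_forall_lt fun a ha b hb => ?_
  lift a to ℝ≥0 using ha.ne_top
  have ha1 : a < 1 := by exact_mod_cast ha
  have h1a : 0 < 1 - a := tsub_pos_of_lt ha1
  -- The bound `λ ≥ σ² / (1 - a)` says `σ⁻² - λ⁻¹ ≥ a σ⁻²`, so monotonicity of `h₁(x) / x` loses at
  -- most the factor `a`. This replaces continuity of the cost in `λ → ∞`.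
  obtain ⟨lam, ⟨hlc, hl1⟩, hl2⟩ := ((hconv.and (eventually_gt_atTop (σ ^ 2))).and
    (eventually_ge_atTop (σ ^ 2 / (1 - a)))).exists
  have hl : 0 < lam := zero_le.trans_lt hl1
  refine le_trans ?_ (h₂_le_cost hc hfin hσ hl1 hlc hΦ he)
  have hx : 0 < (σ ^ 2)⁻¹ - lam⁻¹ := tsub_pos_of_lt (inv_strictAnti₀ (by positivity) hl1)
  have h := CostFunction.div_mul_h₁_le hc hx tsub_le_self
  rw [c.h₁_inv_sq] at h
  have e : c.h₁ d ((σ ^ 2)⁻¹ - lam⁻¹) = c.h₂ lam d (σ ^ 2) := by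
    rw [CostFunction.h₁, CostFunction.h₂]
    congr 2
    have h2 : (lam : ℝ) - σ ^ 2 ≠ 0 := sub_ne_zero.2 (by exact_mod_cast hl1.ne')
    have h3 : (0 : ℝ) < lam := by exact_mod_cast hl
    have h4 : (0 : ℝ) < σ := by exact_mod_cast hσ
    rw [← NNReal.coe_inj, NNReal.coe_div, NNReal.coe_div, NNReal.coe_sub hl1.le,
      NNReal.coe_sub (inv_anti₀ (by positivity) hl1.le)]
    push_cast
    have h5 : ((σ : ℝ) ^ 2)⁻¹ - (lam : ℝ)⁻¹ = (lam - σ ^ 2) / (lam * σ ^ 2) := by field_simp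
    rw [h5, one_div_div]
  rw [e] at h
  refine le_trans ?_ h
  gcongr
  rw [le_div_iff₀ (by positivity), tsub_eq_of_eq_add_rev (a := (σ ^ 2)⁻¹)
    (c := (σ ^ 2)⁻¹ - lam⁻¹) (b := lam⁻¹) (by rw [add_tsub_cancel_of_le]; gcongr)]
  refine le_tsub_of_add_le_right ?_
  have h6 : lam⁻¹ ≤ (1 - a) * (σ ^ 2)⁻¹ := by
    rw [inv_le_comm₀ hl (by positivity), mul_inv, inv_inv, mul_comm, ← div_eq_mul_inv]
    exact hl2
  calc a * (σ ^ 2)⁻¹ + lam⁻¹ ≤ a * (σ ^ 2)⁻¹ + (1 - a) * (σ ^ 2)⁻¹ := by gcongr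
    _ = _ := by rw [← add_mul, add_tsub_cancel_of_le ha1.le, one_mul]

theorem ofReal_div_sq_le_cost {α : ℝ} (hα : ∀ x : ℝ≥0, 0 < x → ENNReal.ofReal (α * x) ≤ c.h₁ d x)
    {Φ : FinSeq → ℝ} (hΦ : Measurable Φ) {σ : ℝ≥0} (hσ : 0 < σ) (he : N.error Φ ≤ σ) :
    ENNReal.ofReal (α / σ ^ 2) ≤ N.cost c d := by
  rcases le_or_gt α 0 with h0 | h0
  · rw [ENNReal.ofReal_of_nonpos (div_nonpos_of_nonpos_of_nonneg h0 (by positivity))]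
    exact zero_le
  lift α to ℝ≥0 using h0.le
  replace h0 : 0 < α := by exact_mod_cast h0
  replace hα : ∀ x : ℝ≥0, 0 < x → (α : ℝ≥0∞) * x ≤ c.h₁ d x := fun x hx => by
    have := hα x hx
    rwa [← NNReal.coe_mul, ENNReal.ofReal_coe_nnreal, ENNReal.coe_mul] at this
  -- The cost at `0` dominates every `h₁(x) ≥ α x`, which is unbounded since `α > 0`.
  have hc0 : c 0 d = ∞ := by
    refine ENNReal.eq_top_of_forall_nnreal_le fun r => ?_
    have h1 : r ≤ α * ((r + 1) / α) := by rw [mul_div_cancel₀ _ h0.ne']; exact le_self_add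
    calc (r : ℝ≥0∞) ≤ α * ((r + 1) / α : ℝ≥0) := by exact_mod_cast h1
      _ ≤ _ := hα _ (by positivity)
      _ ≤ _ := c.antitone_prec d zero_le
  have hpath : ∀ y, α * N.information y ≤ N.pathCost c d y := fun y => by
    refine N.mul_information_le_pathCost fun i => ?_
    set s := N.prec i fun j : Fin i => y.2 (j.castLE i.2.le)
    by_cases hs : s = 0
    · rw [hs, hc0]; exact le_top
    · have := hα (s ^ 2)⁻¹ (by positivity)
      rwa [c.h₁_inv_sq, ENNReal.coe_inv (by positivity), ENNReal.coe_pow] at this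
  set m : ℝ≥0 := σ ^ 2 with hm
  have hm0 : 0 < m := by positivity
  have hgoal : ENNReal.ofReal ((α : ℝ) / σ ^ 2) = α * ((m⁻¹ : ℝ≥0) : ℝ≥0∞) := by
    rw [← NNReal.coe_pow, ← NNReal.coe_div, ENNReal.ofReal_coe_nnreal, div_eq_mul_inv,
      ENNReal.coe_mul]
  rw [hgoal]
  -- Tangent line to `V ↦ V⁻¹` at `m = σ²`; integrated, it is Jensen's inequality for `V⁻¹`.
  have htan : ∀ V : ℝ≥0∞, 2 * ((m⁻¹ : ℝ≥0) : ℝ≥0∞) ≤ V⁻¹ + ((m⁻¹ ^ 2 : ℝ≥0) : ℝ≥0∞) * V := by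
    intro V
    by_cases hV0 : V = 0
    · simp [hV0]
    by_cases hVt : V = ∞
    · rw [hVt, ENNReal.mul_top (by exact_mod_cast (by positivity : (m⁻¹ ^ 2 : ℝ≥0) ≠ 0))]; simp
    lift V to ℝ≥0 using hVt
    have hV0' : V ≠ 0 := by exact_mod_cast hV0
    rw [← ENNReal.coe_inv hV0']
    have h : 2 * m⁻¹ ≤ V⁻¹ + m⁻¹ ^ 2 * V := by
      have hV : (0 : ℝ) < V := by exact_mod_cast pos_iff_ne_zero.2 hV0'
      rw [← NNReal.coe_le_coe]
      push_cast
      have : (V : ℝ)⁻¹ + (m : ℝ)⁻¹ ^ 2 * V - 2 * (m : ℝ)⁻¹ = V * ((V : ℝ)⁻¹ - (m : ℝ)⁻¹) ^ 2 := by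
        field_simp; ring
      nlinarith [mul_nonneg hV.le (sq_nonneg ((V : ℝ)⁻¹ - (m : ℝ)⁻¹))]
    exact_mod_cast h
  refine ENNReal.le_of_forall_pos_le_add fun ε hε _ => ?_
  -- With this prior variance, the prior's own contribution `α / λ` equals `ε`.
  set lam : ℝ≥0 := α / ε with hlam
  have hl : 0 < lam := by positivity
  obtain ⟨ℓ, hℓ⟩ : ∃ ℓ : ℝ, ℓ = ((NNReal.sqrt lam : ℝ≥0) : ℝ) := ⟨_, rfl⟩
  have hℓ2 : ENNReal.ofReal (ℓ ^ 2) = lam := by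
    rw [hℓ, ← NNReal.coe_pow, NNReal.sq_sqrt, ENNReal.ofReal_coe_nnreal]
  have hpt : ∀ y, α * (2 * ((m⁻¹ : ℝ≥0) : ℝ≥0∞)) ≤
      (N.pathCost c d y + ε) + α * ((m⁻¹ ^ 2 : ℝ≥0) : ℝ≥0∞) * N.posteriorVar ℓ y := fun y => by
    refine (mul_le_mul_right (htan (N.posteriorVar ℓ y)) _).trans ?_
    rw [mul_add, ← mul_assoc]
    gcongr
    rw [posteriorVar, inv_inv, hℓ2, mul_add, add_comm]
    gcongr
    · exact hpath y
    · rw [← ENNReal.coe_inv hl.ne', ← ENNReal.coe_mul, hlam, inv_div, mul_div_cancel₀ _ h0.ne']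
  have hint := lintegral_mono (μ := N.bayesLaw ℓ) hpt
  rw [lintegral_const, measure_univ, mul_one,
    lintegral_add_right _ ((N.measurable_posteriorVar ℓ).const_mul _),
    lintegral_add_right _ measurable_const, lintegral_const, measure_univ, mul_one,
    lintegral_const_mul _ (N.measurable_posteriorVar ℓ)] at hint
  have hV := N.lintegral_bayesLaw_posteriorVar_le ℓ hΦ he
  have h2 : α * (2 * ((m⁻¹ : ℝ≥0) : ℝ≥0∞)) ≤
      (N.cost c d + ε) + α * ((m⁻¹ : ℝ≥0) : ℝ≥0∞) := by
    refine hint.trans ?_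
    refine add_le_add (add_le_add_left (N.lintegral_bayesLaw_pathCost_le ℓ c d) _) ?_
    · refine (mul_le_mul_right hV _).trans (le_of_eq ?_)
      rw [mul_assoc, ← ENNReal.coe_pow, ← ENNReal.coe_mul, ← hm, sq, mul_assoc,
        inv_mul_cancel₀ hm0.ne', mul_one]
  rw [two_mul, mul_add] at h2
  exact (ENNReal.add_le_add_iff_right (by finiteness)).1 h2

end AdaptiveInfo

/-! ### Assembly of the three claims. -/

theorem lemma4p2 (c : CostFunction) (d : ℕ+) :
    (ConcaveOn ℝ≥0 (Set.Ioi 0) (c.h₁ d) →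
      (∀ᶠ lam : ℝ≥0 in Filter.atTop, ConvexOn ℝ≥0 (Set.Ioo 0 lam) (c.h₂ lam d)) →
      ∀ σ : ℝ≥0, auxCost c σ d = c σ d) ∧
    (∀ (α : ℝ) (x₀ : ℝ≥0), 0 < x₀ →
      ENNReal.ofReal (α * x₀) = c.h₁ d x₀ →
      (∀ x : ℝ≥0, 0 < x → ENNReal.ofReal (α * x) ≤ c.h₁ d x) →
      ∀ σ₀ : ℝ≥0, σ₀ ^ 2 = 1 / x₀ → ∀ σ : ℝ≥0, 0 < σ →
        ENNReal.ofReal (α / σ ^ 2) ≤ auxCost c σ d ∧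
        auxCost c σ d ≤ (⌈σ₀ ^ 2 / σ ^ 2⌉₊ : ℝ≥0∞) * ENNReal.ofReal (α / σ₀ ^ 2)) ∧
    (∀ σ₀ : ℝ≥0, 0 < σ₀ → ∀ σ : ℝ≥0, 0 < σ →
      auxCost c σ d ≤ (⌈σ₀ ^ 2 / σ ^ 2⌉₊ : ℝ≥0∞) * c σ₀ d) := by
  refine ⟨fun hc hconv σ => le_antisymm ?_ ?_, fun α x₀ hx₀ hα₀ hα σ₀ hσ₀ σ hσ => ⟨?_, ?_⟩,
    fun σ₀ hσ₀ σ hσ => auxCost_le_ceil_mul c d hσ₀ hσ⟩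
  · simpa using auxCost_le_mul c d one_pos (σ₀ := σ) (σ := σ) (by simp)
  · refine le_sInf ?_
    rintro _ ⟨N, Φ, hΦ, he, rfl⟩
    exact AdaptiveInfo.le_cost_of_concave_of_convex hc hconv hΦ he
  · refine le_sInf ?_
    rintro _ ⟨N, Φ, hΦ, he, rfl⟩
    exact AdaptiveInfo.ofReal_div_sq_le_cost hα hΦ hσ he
  · have hpos : 0 < σ₀ := by
      have : 0 < σ₀ ^ 2 := by rw [hσ₀]; positivity
      exact pos_iff_ne_zero.2 fun h => by simp [h] at this
    have hx : x₀ = (σ₀ ^ 2)⁻¹ := by rw [hσ₀, one_div, inv_inv]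
    have h : c σ₀ d = ENNReal.ofReal (α / σ₀ ^ 2) := by
      rw [← c.h₁_inv_sq, ← hx, ← hα₀, hx, div_eq_mul_inv]
      push_cast
      rfl
    rw [← h]
    exact auxCost_le_ceil_mul c d hpos hσ
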